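/- Let $\mathbb{B}=\{0,1\}$ be the Boolean semiring (with $1+1=1$), let $n>2$, and let $M_n(\mathbb{B})$ be the monoid of $n\times n$ matrices over $\mathbb{B}$ under multiplication. A \emph{minimal generating set} of a semigroup $S$ is a generating set of $S$ (as a semigroup) that has the least possible cardinality among all generating sets of $S$ and no proper subset of which generates $S$. Write $S_n\subseteq M_n(\mathbb{B})$ for the group of permutation matrices. Two matrices in $M_n(\mathbb{B})$ are \emph{similar} if each is obtained from the other by permuting rows and/or columns. Let $E$ be the identity matrix with an additional $1$ in row $2$, column $1$, and let $F$ be the identity matrix with its $(1,1)$ entry replaced by $0$; a matrix is \emph{elementary} if it is similar to $E$. A non-unit $A\in M_n(\mathbb{B})$ is \emph{prime} if $A=BC$ implies that $B$ or $C$ is a unit. A \emph{prime $\mathscr{J}$-class} is a class of Green's relation $\mathscr{J}$ on $M_n(\mathbb{B})$ (equality of principal two-sided ideals) that contains a prime matrix. Then every minimal generating set of $M_n(\mathbb{B})$ has the form $\{T',U',E',F'\}\cup P$, where $T'$ and $U'$ generate $S_n$, $E'$ is elementary, $F'$ is similar to $F$, and $P$ is a set of representatives of the prime $\mathscr{J}$-classes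 of $M_n(\mathbb{B})$ (exactly one matrix from each prime $\mathscr{J}$-class, and nothing else). Conversely, every set of this form is a minimal generating set of $M_n(\mathbb{B})$. -/

import Mathlib

/-- The Boolean semiring `𝔹 = {0, 1}`: the usual operations except that `1 + 1 = 1`.
(Mathlib's ring structure on `Bool` has `1 + 1 = 0`, so a separate type is used.) -/
inductive BoolSemiring : Type
  | zero : BoolSemiring
  | one : BoolSemiring
  deriving DecidableEq

namespace BoolSemiring

/-- Addition in the Boolean semiring (logical "or"). -/
def add : BoolSemiring → BoolSemiring → BoolSemiring
  | zero, b => b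
  | one, _ => one

/-- Multiplication in the Boolean semiring (logical "and"). -/
def mul : BoolSemiring → BoolSemiring → BoolSemiring
  | zero, _ => zero
  | one, b => b

instance : Fintype BoolSemiring where
  elems := {zero, one}
  complete := by rintro ⟨⟩ <;> decide

instance : Zero BoolSemiring := ⟨zero⟩

instance : One BoolSemiring := ⟨one⟩

instance : Add BoolSemiring := ⟨add⟩

instance : Mul BoolSemiring := ⟨mul⟩

instance : CommSemiring BoolSemiring where
  add_assoc := by rintro ⟨⟩ ⟨⟩ ⟨⟩ <;> rfl
  zero_add := by rintro ⟨⟩ <;> rfl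
  add_zero := by rintro ⟨⟩ <;> rfl
  add_comm := by rintro ⟨⟩ ⟨⟩ <;> rfl
  nsmul := nsmulRec
  left_distrib := by rintro ⟨⟩ ⟨⟩ ⟨⟩ <;> rfl
  right_distrib := by rintro ⟨⟩ ⟨⟩ ⟨⟩ <;> rfl
  zero_mul := by rintro ⟨⟩ <;> rfl
  mul_zero := by rintro ⟨⟩ <;> rfl
  mul_assoc := by rintro ⟨⟩ ⟨⟩ ⟨⟩ <;> rfl
  one_mul := by rintro ⟨⟩ <;> rfl
  mul_one := by rintro ⟨⟩ <;> rfl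
  mul_comm := by rintro ⟨⟩ ⟨⟩ <;> rfl

end BoolSemiring

/-- `M_n(𝔹)`, the monoid of `n × n` Boolean matrices under matrix multiplication. -/
abbrev BoolMat (n : ℕ) : Type := Matrix (Fin n) (Fin n) BoolSemiring

section Semigroup

universe u

/-- `X` generates the semigroup `S`: every element is a nonempty product of elements of `X`. -/
def Generates {S : Type u} [Semigroup S] (X : Set S) : Prop :=
  Subsemigroup.closure X = ⊤

/-- The rank `d(S)`: the least cardinality of a generating set of the semigroup `S`. -/
noncomputable def semigroupRank (S : Type u) [Semigroup S] : Cardinal.{u} :=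
  sInf {c : Cardinal.{u} | ∃ X : Set S, Generates X ∧ Cardinal.mk X = c}

/-- A minimal generating set of `S`: a generating set that is irredundant (no proper subset
generates `S`) and has cardinality `d(S)`. -/
def IsMinimalGeneratingSet {S : Type u} [Semigroup S] (X : Set S) : Prop :=
  Generates X ∧ (∀ Y : Set S, Y ⊂ X → ¬ Generates Y) ∧ Cardinal.mk X = semigroupRank S

/-- The principal two-sided ideal `S s S` of an element of a monoid `S`. -/
def principalIdeal {S : Type u} [Monoid S] (s : S) : Set S :=
  {t | ∃ x y : S, t = x * s * y}

/-- Green's `𝒥`-relation on a monoid: equality of principal two-sided ideals. -/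
def GreenJ {S : Type u} [Monoid S] (s t : S) : Prop :=
  principalIdeal s = principalIdeal t

/-- The `𝒥`-class of `s`. -/
def jClass {S : Type u} [Monoid S] (s : S) : Set S :=
  {t | GreenJ s t}

end Semigroup

namespace BoolMat

/-- `S_n` inside `M_n(𝔹)`: the set of permutation matrices. -/
def symmetricGroup (n : ℕ) : Set (BoolMat n) :=
  Set.range fun σ : Equiv.Perm (Fin n) => Equiv.Perm.permMatrix BoolSemiring σ

/-- `A` and `B` are similar: `B` is obtained from `A` by permuting rows and columns. -/
def Similar {n : ℕ} (A B : BoolMat n) : Prop :=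
  ∃ σ τ : Equiv.Perm (Fin n), B = A.submatrix σ τ

/-- The matrix `E`: the identity matrix with an additional `1` in row 2, column 1
(rows and columns numbered from 1). -/
def matE (n : ℕ) : BoolMat n :=
  Matrix.of fun i j => if i = j ∨ (i.val = 1 ∧ j.val = 0) then 1 else 0

/-- The matrix `F`: the identity matrix with the `1` in row 1, column 1 replaced by `0`
(rows and columns numbered from 1). -/
def matF (n : ℕ) : BoolMat n :=
  Matrix.of fun i j => if i = j ∧ i.val ≠ 0 then 1 else 0

/-- An elementary matrix: a matrix similar to `E`. -/
def IsElementary {n : ℕ} (A : BoolMat n) : Prop :=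
  Similar A (matE n)

/-- A prime matrix: a non-unit `A` such that `A = B * C` implies that `B` or `C` is a unit. -/
def IsPrimeMatrix {n : ℕ} (A : BoolMat n) : Prop :=
  ¬ IsUnit A ∧ ∀ B C : BoolMat n, A = B * C → IsUnit B ∨ IsUnit C

/-- A prime `𝒥`-class: a `𝒥`-class that contains a prime matrix. -/
def IsPrimeJClass {n : ℕ} (J : Set (BoolMat n)) : Prop :=
  ∃ A : BoolMat n, IsPrimeMatrix A ∧ J = jClass A

/-- `P` is a set of representatives of the prime `𝒥`-classes: every element of `P` lies in a prime
`𝒥`-class, and every prime `𝒥`-class contains exactly one element of `P`. -/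
def IsPrimeRepresentatives {n : ℕ} (P : Set (BoolMat n)) : Prop :=
  (∀ A ∈ P, IsPrimeJClass (jClass A)) ∧
    ∀ J : Set (BoolMat n), IsPrimeJClass J → ∃! A : BoolMat n, A ∈ P ∧ A ∈ J

/-- The set `{T, U}` generates `S_n` (in particular `T` and `U` are permutation matrices). -/
def GenerateSymmetricGroup {n : ℕ} (T U : BoolMat n) : Prop :=
  (Subsemigroup.closure {T, U} : Set (BoolMat n)) = symmetricGroup n

end BoolMat

/-! Generation. Let `A` be neither a unit nor prime. If `A` has a zero row, a matrix similar to `F`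
splits off and the cofactor generates a strictly larger principal left ideal. If one nonzero row
lies below another, an elementary matrix splits off and the cofactor has fewer ones. Columns follow
by transposition. If no row lies below another and no column below another, `A * M = A` forces `M =
1`, so both factors of a factorisation into non-units generate strictly larger principal ideals on
one side. Induction on ideal size, then on the number of ones, shows that units, elementary
matrices, matrices similar to `F` and primes generate (`eq_top_of_forall_mem`).

Lower bound. Every generating set contains at least two units (`S_n` is not commutative for `n >
2`), an elementary matrix (`IsElementary.of_mul`), a matrix similar to each prime, and a matrix with
a zero row. These four kinds are disjoint, so a generating set has at least `4 + |P|` elements, and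
every set of the stated form attains this.

Equality. In a smallest generating set, exactly one element `F'` is neither unit, elementary nor
prime. Some generator has a zero row and some has a zero column, and both must be `F'`. Following a
word for `F` through `matF_eq_mul` then shows that `F'` is similar to `F`. -/

/-! ### Arithmetic of the Boolean semiring -/

namespace BoolSemiring

@[simp] theorem zero_ne_one' : (0 : BoolSemiring) ≠ 1 := by decide

theorem eq_of_eq_one_iff {a b : BoolSemiring} (h : a = 1 ↔ b = 1) : a = b := by
  rcases a with _ | _ <;> rcases b with _ | _ <;> revert h <;> decide

theorem add_eq_one {a b : BoolSemiring} : a + b = 1 ↔ a = 1 ∨ b = 1 := by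
  rcases a with _ | _ <;> rcases b with _ | _ <;> decide

theorem mul_eq_one' {a b : BoolSemiring} : a * b = 1 ↔ a = 1 ∧ b = 1 := by
  rcases a with _ | _ <;> rcases b with _ | _ <;> decide

theorem sum_eq_one {ι : Type*} (s : Finset ι) (f : ι → BoolSemiring) :
    ∑ i ∈ s, f i = 1 ↔ ∃ i ∈ s, f i = 1 := by
  classical
  induction s using Finset.induction with
  | empty => simp
  | insert a s ha ih => rw [Finset.sum_insert ha, add_eq_one, ih]; simp

end BoolSemiring

/-! ### Units and principal ideals in finite monoids -/

section FiniteMonoid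

variable {M : Type*} [Monoid M] [Finite M]

theorem exists_mul_eq_one_symm_of_finite {a b : M} (h : a * b = 1) : b * a = 1 := by
  have hinj : Function.Injective (fun x : M => b * x) := fun x y hxy => by
    have := congrArg (a * ·) hxy
    simpa [← mul_assoc, h] using this
  obtain ⟨c, hc⟩ := Finite.surjective_of_injective hinj 1
  have hc : b * c = 1 := hc
  have : a = c := by
    calc a = a * (b * c) := by rw [hc, mul_one]
      _ = c := by rw [← mul_assoc, h, one_mul]
  rw [this, hc]

theorem isUnit_of_mul_eq_one_of_finite {a b : M} (h : a * b = 1) : IsUnit a ∧ IsUnit b :=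
  ⟨⟨⟨a, b, h, exists_mul_eq_one_symm_of_finite h⟩, rfl⟩,
    ⟨⟨b, a, exists_mul_eq_one_symm_of_finite h, h⟩, rfl⟩⟩

theorem isUnit_mul_iff_of_finite {a b : M} : IsUnit (a * b) ↔ IsUnit a ∧ IsUnit b := by
  refine ⟨fun h => ?_, fun h => h.1.mul h.2⟩
  obtain ⟨c, hc⟩ := h.exists_right_inv
  obtain ⟨d, hd⟩ := h.exists_left_inv
  rw [mul_assoc] at hc
  rw [← mul_assoc] at hd
  exact ⟨(isUnit_of_mul_eq_one_of_finite hc).1, (isUnit_of_mul_eq_one_of_finite hd).2⟩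

/-- The number of elements of the principal left ideal plus that of the principal right ideal. -/
noncomputable def idealSize (a : M) : ℕ :=
  (Set.range fun x => x * a).ncard + (Set.range fun x => a * x).ncard

theorem idealSize_le_right (a b : M) : idealSize (a * b) ≤ idealSize b := by
  unfold idealSize
  refine add_le_add (Set.ncard_le_ncard ?_ (Set.toFinite _)) ?_
  · rintro _ ⟨x, rfl⟩
    exact ⟨x * a, by simp [mul_assoc]⟩
  · have : (Set.range fun x => a * b * x) = (a * ·) '' (Set.range fun x => b * x) := by
      rw [← Set.range_comp]
      simp [Function.comp_def, mul_assoc]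
    rw [this]
    exact Set.ncard_image_le (Set.toFinite _)

theorem idealSize_le_left (a b : M) : idealSize (a * b) ≤ idealSize a := by
  unfold idealSize
  refine add_le_add ?_ (Set.ncard_le_ncard ?_ (Set.toFinite _))
  · have : (Set.range fun x => x * (a * b)) = (· * b) '' (Set.range fun x => x * a) := by
      rw [← Set.range_comp]
      simp [Function.comp_def, mul_assoc]
    rw [this]
    exact Set.ncard_image_le (Set.toFinite _)
  · rintro _ ⟨x, rfl⟩
    exact ⟨b * x, by simp [mul_assoc]⟩

/-- The inclusion of `M(ab)` in `Mb` is strict because it misses `b`, while `abM` is an image of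
`bM` and so is no larger. -/
theorem idealSize_lt_right {a b : M} (h : ∀ x, b ≠ x * (a * b)) :
    idealSize (a * b) < idealSize b := by
  unfold idealSize
  refine add_lt_add_of_lt_of_le (Set.ncard_lt_ncard ⟨?_, fun hs => ?_⟩ (Set.toFinite _)) ?_
  · rintro _ ⟨x, rfl⟩
    exact ⟨x * a, by simp [mul_assoc]⟩
  · obtain ⟨x, hx⟩ := hs ⟨1, one_mul b⟩
    exact h x hx.symm
  · have : (Set.range fun x => a * b * x) = (a * ·) '' (Set.range fun x => b * x) := by
      rw [← Set.range_comp]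
      simp [Function.comp_def, mul_assoc]
    rw [this]
    exact Set.ncard_image_le (Set.toFinite _)

theorem idealSize_lt_left {a b : M} (h : ∀ x, a ≠ a * b * x) :
    idealSize (a * b) < idealSize a := by
  unfold idealSize
  refine add_lt_add_of_le_of_lt ?_ (Set.ncard_lt_ncard ⟨?_, fun hs => ?_⟩ (Set.toFinite _))
  · have : (Set.range fun x => x * (a * b)) = (· * b) '' (Set.range fun x => x * a) := by
      rw [← Set.range_comp]
      simp [Function.comp_def, mul_assoc]
    rw [this]
    exact Set.ncard_image_le (Set.toFinite _)
  · rintro _ ⟨x, rfl⟩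
    exact ⟨b * x, by simp [mul_assoc]⟩
  · obtain ⟨x, hx⟩ := hs ⟨1, mul_one a⟩
    exact h x hx.symm

theorem idealSize_le (a : M) : idealSize a ≤ Nat.card M + Nat.card M :=
  add_le_add (Set.ncard_le_card _) (Set.ncard_le_card _)

end FiniteMonoid

/-! ### Boolean matrices, units and similarity -/

namespace BoolMat

open BoolSemiring

variable {n : ℕ}

instance : Finite (BoolMat n) := inferInstanceAs (Finite (Fin n → Fin n → BoolSemiring))

theorem mul_apply_eq_one (A B : BoolMat n) (i j : Fin n) :
    (A * B) i j = 1 ↔ ∃ k, A i k = 1 ∧ B k j = 1 := by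
  simp [Matrix.mul_apply, sum_eq_one, mul_eq_one']

theorem ext_one {A B : BoolMat n} (h : ∀ i j, A i j = 1 ↔ B i j = 1) : A = B :=
  Matrix.ext fun i j => eq_of_eq_one_iff (h i j)

theorem one_apply_eq_one (i j : Fin n) : (1 : BoolMat n) i j = 1 ↔ i = j := by
  rw [Matrix.one_apply]
  split_ifs with h <;> simp [h]

open Classical in
/-- The Boolean matrix of a relation. -/
noncomputable def ofRel (r : Fin n → Fin n → Prop) : BoolMat n :=
  Matrix.of fun i j => if r i j then 1 else 0

@[simp] theorem ofRel_apply (r : Fin n → Fin n → Prop) (i j : Fin n) :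
    ofRel r i j = 1 ↔ r i j := by
  simp only [ofRel, Matrix.of_apply]
  split_ifs with h <;> simp [h]

theorem permMatrix_apply_eq_one (σ : Equiv.Perm (Fin n)) (i j : Fin n) :
    σ.permMatrix BoolSemiring i j = 1 ↔ σ i = j := by
  rw [Equiv.Perm.permMatrix, PEquiv.toMatrix_apply]
  simp only [Equiv.toPEquiv_apply, Option.mem_def, Option.some.injEq]
  split_ifs with h <;> simp [h]

theorem permMatrix_mul_apply (σ : Equiv.Perm (Fin n)) (A : BoolMat n) :
    σ.permMatrix BoolSemiring * A = A.submatrix σ id :=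
  PEquiv.toMatrix_toPEquiv_mul _ _

theorem mul_permMatrix_apply (σ : Equiv.Perm (Fin n)) (A : BoolMat n) :
    A * σ.permMatrix BoolSemiring = A.submatrix id σ.symm :=
  PEquiv.mul_toMatrix_toPEquiv _ _

theorem isUnit_permMatrix (σ : Equiv.Perm (Fin n)) : IsUnit (σ.permMatrix BoolSemiring) := by
  have h : σ.permMatrix BoolSemiring * (σ⁻¹).permMatrix BoolSemiring = 1 := by
    rw [← Matrix.permMatrix_mul]; simp
  exact (isUnit_of_mul_eq_one_of_finite h).1

/-- If `B * C` has ones on the diagonal at the places in `s`, and no two-cycles there, then up to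
a permutation so have `B` and `C`. -/
theorem exists_perm_of_mul (B C : BoolMat n) (s : Set (Fin n))
    (h1 : ∀ i ∈ s, (B * C) i i = 1)
    (h2 : ∀ i ∈ s, ∀ j ∈ s, (B * C) i j = 1 → (B * C) j i = 1 → i = j) :
    ∃ σ : Equiv.Perm (Fin n), ∀ i ∈ s, B i (σ i) = 1 ∧ C (σ i) i = 1 := by
  classical
  have h3 : ∀ i, ∃ k, i ∈ s → B i k = 1 ∧ C k i = 1 := fun i => by
    by_cases hi : i ∈ s
    · obtain ⟨k, hk⟩ := (mul_apply_eq_one _ _ _ _).1 (h1 i hi)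
      exact ⟨k, fun _ => hk⟩
    · exact ⟨i, fun h => absurd h hi⟩
  choose f hf using h3
  -- A shared middle index `f i = f j` would put ones at both `(i, j)` and `(j, i)` of the product.
  have hinj : Set.InjOn f s := fun i hi j hj hij =>
    h2 i hi j hj
      ((mul_apply_eq_one _ _ _ _).2 ⟨f i, (hf i hi).1, hij ▸ (hf j hj).2⟩)
      ((mul_apply_eq_one _ _ _ _).2 ⟨f j, (hf j hj).1, hij ▸ (hf i hi).2⟩)
  obtain ⟨g, hg⟩ := Set.MapsTo.exists_equiv_extend_of_card_eq (t := Finset.univ) (s := s) (f := f)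
    (by simp) (fun _ _ => by simp) hinj
  refine ⟨g.trans (Equiv.subtypeUnivEquiv (by simp)), fun i hi => ?_⟩
  have : (g.trans (Equiv.subtypeUnivEquiv (by simp))) i = f i := hg i hi
  rw [this]
  exact hf i hi

theorem isUnit_iff_mem_symmetricGroup (A : BoolMat n) :
    IsUnit A ↔ A ∈ symmetricGroup n := by
  refine ⟨fun h => ?_, ?_⟩
  · obtain ⟨B, hB⟩ := h.exists_right_inv
    obtain ⟨σ, hσ⟩ := exists_perm_of_mul A B Set.univ
      (fun i _ => by rw [hB, one_apply_eq_one])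
      (fun i _ j _ hij _ => by rwa [hB, one_apply_eq_one] at hij)
    refine ⟨σ, ext_one fun i j => ?_⟩
    rw [permMatrix_apply_eq_one]
    refine ⟨fun h => h ▸ (hσ i trivial).1, fun h => ?_⟩
    have h1 : (A * B) i (σ.symm j) = 1 := (mul_apply_eq_one _ _ _ _).2
      ⟨j, h, by simpa using (hσ (σ.symm j) trivial).2⟩
    rw [hB, one_apply_eq_one] at h1
    rw [h1, Equiv.apply_symm_apply]
  · rintro ⟨σ, rfl⟩
    exact isUnit_permMatrix σ

theorem similar_iff (A B : BoolMat n) :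
    Similar A B ↔ ∃ U V : BoolMat n, IsUnit U ∧ IsUnit V ∧ B = U * A * V := by
  constructor
  · rintro ⟨σ, τ, rfl⟩
    refine ⟨σ.permMatrix _, (τ⁻¹).permMatrix _, isUnit_permMatrix _, isUnit_permMatrix _, ?_⟩
    rw [permMatrix_mul_apply, mul_permMatrix_apply]
    rfl
  · rintro ⟨U, V, hU, hV, rfl⟩
    rw [isUnit_iff_mem_symmetricGroup] at hU hV
    obtain ⟨σ, rfl⟩ := hU
    obtain ⟨τ, rfl⟩ := hV
    refine ⟨σ, τ.symm, ?_⟩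
    simp only [permMatrix_mul_apply, mul_permMatrix_apply]
    rfl

theorem Similar.refl (A : BoolMat n) : Similar A A := ⟨1, 1, rfl⟩

theorem Similar.symm {A B : BoolMat n} : Similar A B → Similar B A := by
  rintro ⟨σ, τ, rfl⟩
  exact ⟨σ.symm, τ.symm, by ext; simp⟩

theorem Similar.trans {A B C : BoolMat n} : Similar A B → Similar B C → Similar A C := by
  rintro ⟨σ, τ, rfl⟩ ⟨σ', τ', rfl⟩
  exact ⟨σ'.trans σ, τ'.trans τ, by ext; simp⟩

theorem Similar.isUnit_iff {A B : BoolMat n} (h : Similar A B) : IsUnit A ↔ IsUnit B := by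
  obtain ⟨U, V, hU, hV, rfl⟩ := (similar_iff _ _).1 h
  simp [hU, hV]

theorem similar_mul_left {U : BoolMat n} (hU : IsUnit U) (A : BoolMat n) : Similar (U * A) A := by
  exact Similar.symm ((similar_iff _ _).2 ⟨U, 1, hU, isUnit_one, by simp⟩)

theorem similar_mul_right {U : BoolMat n} (hU : IsUnit U) (A : BoolMat n) : Similar (A * U) A := by
  exact Similar.symm ((similar_iff _ _).2 ⟨1, U, isUnit_one, hU, by simp⟩)

/-! ### Primes and their `𝒥`-classes -/

theorem IsPrimeMatrix.similar {A B : BoolMat n} (hA : IsPrimeMatrix A) (h : Similar A B) :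
    IsPrimeMatrix B := by
  refine ⟨fun hB => hA.1 (h.isUnit_iff.2 hB), fun C D hCD => ?_⟩
  obtain ⟨U, V, hU, hV, rfl⟩ := (similar_iff _ _).1 h.symm
  have := hA.2 (U * C) (D * V) (by rw [hCD]; simp only [mul_assoc])
  simpa [isUnit_mul_iff_of_finite, hU, hV] using this

/-- In `A = u * B * v` the matrix `B` is not a unit, since otherwise `B = x * A * y` would make its
factor `A` a unit. Primality of `A` therefore makes `u` and `v` units. -/
theorem IsPrimeMatrix.similar_of_greenJ {A B : BoolMat n} (hA : IsPrimeMatrix A)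
    (h : GreenJ A B) : Similar A B := by
  have hB : B ∈ principalIdeal A := by
    rw [show principalIdeal A = principalIdeal B from h]
    exact ⟨1, 1, by simp⟩
  have hA' : A ∈ principalIdeal B := by
    rw [← show principalIdeal A = principalIdeal B from h]
    exact ⟨1, 1, by simp⟩
  obtain ⟨x, y, hxy⟩ := hB
  obtain ⟨u, v, huv⟩ := hA'
  have hBu : ¬ IsUnit B := fun hu => by
    rw [hxy, isUnit_mul_iff_of_finite, isUnit_mul_iff_of_finite] at hu
    exact hA.1 hu.1.2
  have hu : IsUnit u := by
    rcases hA.2 u (B * v) (by rw [huv, mul_assoc]) with h | h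
    · exact h
    · exact absurd (isUnit_mul_iff_of_finite.1 h).1 hBu
  have hv : IsUnit v := by
    rcases hA.2 (u * B) v huv with h | h
    · exact absurd (isUnit_mul_iff_of_finite.1 h).2 hBu
    · exact h
  exact Similar.symm ((similar_iff _ _).2 ⟨u, v, hu, hv, huv⟩)

theorem Similar.greenJ {A B : BoolMat n} (h : Similar A B) : GreenJ A B := by
  have key : ∀ {A B : BoolMat n}, Similar A B → principalIdeal B ⊆ principalIdeal A := by
    rintro A B h _ ⟨x, y, rfl⟩
    obtain ⟨U, V, -, -, rfl⟩ := (similar_iff _ _).1 h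
    exact ⟨x * U, V * y, by simp only [mul_assoc]⟩
  exact (key h.symm).antisymm (key h)

theorem jClass_eq_iff (A B : BoolMat n) : jClass A = jClass B ↔ GreenJ A B := by
  constructor
  · intro h
    have : B ∈ jClass B := rfl
    rw [← h] at this
    exact this
  · intro h
    ext C
    simp only [jClass, GreenJ, Set.mem_ofPred_eq] at h ⊢
    rw [h]

theorem isPrimeJClass_jClass_iff (A : BoolMat n) : IsPrimeJClass (jClass A) ↔ IsPrimeMatrix A := by
  refine ⟨?_, fun h => ⟨A, h, rfl⟩⟩
  rintro ⟨B, hB, h⟩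
  exact hB.similar (hB.similar_of_greenJ ((jClass_eq_iff _ _).1 h.symm))

theorem IsPrimeMatrix.mem_jClass_iff {A B : BoolMat n} (hA : IsPrimeMatrix A) :
    B ∈ jClass A ↔ Similar A B :=
  ⟨fun h => hA.similar_of_greenJ h, fun h => h.greenJ⟩

theorem isPrimeRepresentatives_iff (P : Set (BoolMat n)) :
    IsPrimeRepresentatives P ↔
      (∀ A ∈ P, IsPrimeMatrix A) ∧ ∀ A, IsPrimeMatrix A → ∃! B, B ∈ P ∧ Similar A B := by
  simp only [IsPrimeRepresentatives, isPrimeJClass_jClass_iff]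
  refine and_congr_right fun _ => ⟨fun h A hA => ?_, ?_⟩
  · simpa only [hA.mem_jClass_iff] using h (jClass A) ⟨A, hA, rfl⟩
  · rintro h _ ⟨A, hA, rfl⟩
    simpa only [hA.mem_jClass_iff] using h A hA

/-! ### Factorisations of `E` and `F` -/

theorem matE_apply_eq_one (i j : Fin n) :
    matE n i j = 1 ↔ i = j ∨ (i.val = 1 ∧ j.val = 0) := by
  simp only [matE, Matrix.of_apply]
  split_ifs with h <;> simp [h]

theorem matF_apply_eq_one (i j : Fin n) : matF n i j = 1 ↔ i = j ∧ i.val ≠ 0 := by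
  simp only [matF, Matrix.of_apply]
  split_ifs with h
  · exact iff_of_true rfl h
  · exact iff_of_false (by simp) h

theorem exists_similar_of_mul (B C : BoolMat n) (s : Set (Fin n))
    (h1 : ∀ i ∈ s, (B * C) i i = 1)
    (h2 : ∀ i ∈ s, ∀ j ∈ s, (B * C) i j = 1 → (B * C) j i = 1 → i = j) :
    ∃ B' C' : BoolMat n, Similar B B' ∧ Similar C C' ∧ B * C = B' * C' ∧
      ∀ i ∈ s, B' i i = 1 ∧ C' i i = 1 := by
  obtain ⟨σ, hσ⟩ := exists_perm_of_mul B C s h1 h2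
  refine ⟨B.submatrix id σ, C.submatrix σ id, ⟨1, σ, rfl⟩, ⟨σ, 1, rfl⟩, ?_, fun i hi => hσ i hi⟩
  rw [Matrix.submatrix_mul_equiv]
  rfl

/-- After normalisation both factors have a full diagonal, so the left factor lies between `1` and
`E`. These differ in a single entry, so it equals one of them. -/
theorem similar_or_similar_of_matE_eq_mul {B C : BoolMat n} (h : matE n = B * C) :
    Similar B (matE n) ∨ Similar C (matE n) := by
  obtain ⟨B', C', hB, hC, hBC, hd⟩ := exists_similar_of_mul B C Set.univ
    (fun i _ => by rw [← h, matE_apply_eq_one]; exact Or.inl rfl)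
    (fun i _ j _ hij hji => by
      rw [← h, matE_apply_eq_one] at hij hji
      rcases hij with hij | hij
      · exact hij
      · rcases hji with hji | hji
        · exact hji.symm
        · omega)
  rw [← h] at hBC
  have hBle : ∀ i j, B' i j = 1 → i = j ∨ (i.val = 1 ∧ j.val = 0) := fun i j hij => by
    rw [← matE_apply_eq_one, hBC, mul_apply_eq_one]
    exact ⟨j, hij, (hd j trivial).2⟩
  by_cases hB' : B' = 1
  · right
    rw [hB', one_mul] at hBC
    rwa [hBC]
  · left
    have : ∃ i j, B' i j = 1 ∧ i ≠ j := by
      by_contra! hcon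
      refine hB' (ext_one fun i j => ?_)
      rw [one_apply_eq_one]
      exact ⟨hcon i j, fun hij => hij ▸ (hd i trivial).1⟩
    obtain ⟨i, j, hij, hne⟩ := this
    have hij' := (hBle i j hij).resolve_left hne
    have : B' = matE n := ext_one fun a b => by
      rw [matE_apply_eq_one]
      refine ⟨hBle a b, ?_⟩
      rintro (rfl | hab)
      · exact (hd a trivial).1
      · have ha : a = i := Fin.ext (by omega)
        have hb : b = j := Fin.ext (by omega)
        rw [ha, hb, hij]
    rwa [← this]

theorem IsElementary.of_mul {B C : BoolMat n} (h : IsElementary (B * C)) :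
    IsElementary B ∨ IsElementary C := by
  obtain ⟨U, V, hU, hV, hUV⟩ := (similar_iff _ _).1 h
  rcases similar_or_similar_of_matE_eq_mul (B := U * B) (C := C * V)
    (by rw [hUV]; simp only [mul_assoc]) with h | h
  · exact Or.inl ((similar_mul_left hU B).symm.trans h)
  · exact Or.inr ((similar_mul_right hV C).symm.trans h)

/-- The matrix has a row without ones. -/
def HasZeroRow (A : BoolMat n) : Prop := ∃ i, ∀ j, A i j ≠ 1

/-- The matrix has a column without ones. -/
def HasZeroCol (A : BoolMat n) : Prop := ∃ j, ∀ i, A i j ≠ 1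

theorem HasZeroRow.similar {A B : BoolMat n} (h : HasZeroRow A) (hAB : Similar A B) :
    HasZeroRow B := by
  obtain ⟨σ, τ, rfl⟩ := hAB
  obtain ⟨i, hi⟩ := h
  exact ⟨σ.symm i, fun j => by simpa using hi _⟩

theorem HasZeroCol.similar {A B : BoolMat n} (h : HasZeroCol A) (hAB : Similar A B) :
    HasZeroCol B := by
  obtain ⟨σ, τ, rfl⟩ := hAB
  obtain ⟨i, hi⟩ := h
  exact ⟨τ.symm i, fun j => by simpa using hi _⟩

theorem HasZeroRow.of_mul {A B : BoolMat n} (h : HasZeroRow (A * B)) :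
    HasZeroRow A ∨ HasZeroRow B := by
  by_contra! hcon
  obtain ⟨h1, h2⟩ := hcon
  simp only [HasZeroRow, not_exists, not_forall, not_not] at h1 h2
  obtain ⟨i, hi⟩ := h
  obtain ⟨k, hk⟩ := h1 i
  obtain ⟨j, hj⟩ := h2 k
  exact hi j ((mul_apply_eq_one _ _ _ _).2 ⟨k, hk, hj⟩)

theorem HasZeroCol.of_mul {A B : BoolMat n} (h : HasZeroCol (A * B)) :
    HasZeroCol A ∨ HasZeroCol B := by
  by_contra! hcon
  obtain ⟨h1, h2⟩ := hcon
  simp only [HasZeroCol, not_exists, not_forall, not_not] at h1 h2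
  obtain ⟨i, hi⟩ := h
  obtain ⟨k, hk⟩ := h2 i
  obtain ⟨j, hj⟩ := h1 k
  exact hi j ((mul_apply_eq_one _ _ _ _).2 ⟨k, hj, hk⟩)

/-- After normalisation, `B` agrees with `F` outside its first column and `C` agrees with `F`
outside its first row. A one in the corner of `B` forces the first row of `C` to vanish. Otherwise
the first row of `B` vanishes, but its first column stays free, whence the proviso about a zero
column. -/
theorem matF_eq_mul (hn : 0 < n) {B C : BoolMat n} (h : matF n = B * C) :
    Similar C (matF n) ∨ (HasZeroRow B ∧ (HasZeroCol B → Similar B (matF n))) := by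
  obtain ⟨B', C', hB, hC, hBC, hd⟩ := exists_similar_of_mul B C {i | i.val ≠ 0}
    (fun i hi => by rw [← h, matF_apply_eq_one]; exact ⟨rfl, hi⟩)
    (fun i _ j _ hij _ => by
      rw [← h, matF_apply_eq_one] at hij
      exact hij.1)
  rw [← h] at hBC
  have hBle : ∀ i j, B' i j = 1 → j.val ≠ 0 → i = j ∧ i.val ≠ 0 := fun i j hij hj => by
    rw [← matF_apply_eq_one, hBC, mul_apply_eq_one]
    exact ⟨j, hij, (hd j hj).2⟩
  have hCle : ∀ i j, C' i j = 1 → i.val ≠ 0 → i = j ∧ i.val ≠ 0 := fun i j hij hi => by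
    rw [← matF_apply_eq_one, hBC, mul_apply_eq_one]
    exact ⟨i, (hd i hi).1, hij⟩
  by_cases h0 : B' ⟨0, hn⟩ ⟨0, hn⟩ = 1
  · left
    have : C' = matF n := ext_one fun i j => by
      rw [matF_apply_eq_one]
      refine ⟨fun hij => ?_, fun hij => hij.1 ▸ (hd i hij.2).2⟩
      by_cases hi : i.val = 0
      · have hi' : i = ⟨0, hn⟩ := Fin.ext hi
        have : matF n ⟨0, hn⟩ j = 1 := by
          rw [hBC, mul_apply_eq_one]
          exact ⟨_, h0, hi' ▸ hij⟩
        rw [matF_apply_eq_one] at this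
        exact absurd rfl this.2
      · exact hCle i j hij hi
    rwa [← this]
  · right
    have hrow : ∀ j, B' ⟨0, hn⟩ j ≠ 1 := fun j hj => by
      by_cases hj0 : j.val = 0
      · exact h0 (by rwa [show j = ⟨0, hn⟩ from Fin.ext hj0] at hj)
      · exact (hBle _ _ hj hj0).2 rfl
    refine ⟨HasZeroRow.similar ⟨_, hrow⟩ hB.symm, fun hcol => ?_⟩
    obtain ⟨k, hk⟩ := hcol.similar hB
    have hk0 : k.val = 0 := by
      by_contra hk0
      exact hk k (hd k hk0).1
    have : B' = matF n := ext_one fun i j => by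
      rw [matF_apply_eq_one]
      refine ⟨fun hij => ?_, fun hij => hij.1 ▸ (hd i hij.2).1⟩
      by_cases hj : j.val = 0
      · exact absurd (by rwa [show j = k from Fin.ext (hj.trans hk0.symm)] at hij) (hk i)
      · exact hBle i j hij hj
    rwa [← this]

theorem similar_matF_mul (hn : 0 < n) {B C : BoolMat n} (h : Similar (B * C) (matF n)) :
    Similar C (matF n) ∨ (HasZeroRow B ∧ (HasZeroCol B → Similar B (matF n))) := by
  obtain ⟨U, V, hU, hV, hUV⟩ := (similar_iff _ _).1 h
  rcases matF_eq_mul hn (B := U * B) (C := C * V)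
    (by rw [hUV]; simp only [mul_assoc]) with h | h
  · exact Or.inl ((similar_mul_right hV C).symm.trans h)
  · have hs := similar_mul_left hU B
    exact Or.inr ⟨h.1.similar hs, fun hc => hs.symm.trans (h.2 (hc.similar hs.symm))⟩

/-! ### Splitting off copies of `F` and `E` -/

/-- The identity matrix with row `i` replaced by zero. -/
noncomputable def zeroDiag (i : Fin n) : BoolMat n := ofRel fun a b => a = b ∧ a ≠ i

/-- The identity matrix with an additional one in row `j` and column `i`. -/
noncomputable def transvec (j i : Fin n) : BoolMat n := ofRel fun a b => a = b ∨ (a = j ∧ b = i)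

theorem zeroDiag_similar (i : Fin n) : Similar (zeroDiag i) (matF n) := by
  have hn : 0 < n := i.pos
  refine ⟨Equiv.swap ⟨0, hn⟩ i, Equiv.swap ⟨0, hn⟩ i, ext_one fun a b => ?_⟩
  rw [matF_apply_eq_one, Matrix.submatrix_apply, zeroDiag, ofRel_apply]
  have : Equiv.swap (⟨0, hn⟩ : Fin n) i a = i ↔ a.val = 0 := by
    rw [Equiv.swap_apply_eq_iff, Equiv.swap_apply_right, Fin.ext_iff]
  simp [this]

theorem transvec_isElementary {i j : Fin n} (hij : j ≠ i) : IsElementary (transvec j i) := by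
  have hn : 1 < n := by
    by_contra hn
    exact hij (Fin.ext (by omega))
  set z : Fin n := ⟨0, by omega⟩ with hz
  set o : Fin n := ⟨1, hn⟩ with ho
  have hzo : z ≠ o := by simp [hz, ho]
  obtain ⟨σ, hσz, hσo⟩ : ∃ σ : Equiv.Perm (Fin n), σ z = i ∧ σ o = j := by
    -- The first swap sends `z` to `i`. The second carries the image of `o` to `j` and fixes `i`,
    -- which is neither of the two points it exchanges.
    refine ⟨(Equiv.swap z i).trans (Equiv.swap (Equiv.swap z i o) j), ?_, ?_⟩
    · rw [Equiv.trans_apply, Equiv.swap_apply_left, Equiv.swap_apply_of_ne_of_ne _ hij.symm]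
      intro h
      rw [eq_comm, Equiv.swap_apply_eq_iff, Equiv.swap_apply_right] at h
      exact hzo h.symm
    · rw [Equiv.trans_apply, Equiv.swap_apply_left]
  refine ⟨σ, σ, ext_one fun a b => ?_⟩
  rw [matE_apply_eq_one, Matrix.submatrix_apply, transvec, ofRel_apply]
  rw [← hσz, ← hσo]
  simp only [EmbeddingLike.apply_eq_iff_eq, Fin.ext_iff, hz, ho]

theorem Similar.transpose {A B : BoolMat n} (h : Similar A B) : Similar A.transpose B.transpose := by
  obtain ⟨σ, τ, rfl⟩ := h
  exact ⟨τ, σ, rfl⟩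

theorem matF_transpose : (matF n).transpose = matF n := ext_one fun i j => by
  rw [Matrix.transpose_apply, matF_apply_eq_one, matF_apply_eq_one]
  constructor <;> rintro ⟨rfl, h⟩ <;> exact ⟨rfl, h⟩

theorem IsElementary.transpose {A : BoolMat n} (h : IsElementary A) (hn : 1 < n) :
    IsElementary A.transpose := by
  have h0 : IsElementary (transvec ⟨0, by omega⟩ ⟨1, hn⟩ : BoolMat n) :=
    transvec_isElementary (by simp)
  refine Similar.trans (Similar.transpose h) ?_
  have : (matE n).transpose = transvec ⟨0, by omega⟩ ⟨1, hn⟩ := ext_one fun i j => by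
    rw [Matrix.transpose_apply, matE_apply_eq_one, transvec, ofRel_apply]
    simp only [Fin.ext_iff]
    omega
  rw [this]
  exact h0

/-- Since `A` has a zero row, its rows cannot include all `n` unit vectors. Let `A'` be `A` with the
zero row replaced by a missing unit vector. If `A' = X * A`, this vector would be a union of rows of
`A`, and any nonzero row in the union would equal it. -/
theorem exists_factor_of_hasZeroRow {A : BoolMat n} (h : HasZeroRow A) :
    ∃ G A' : BoolMat n, Similar G (matF n) ∧ A = G * A' ∧ ∀ X : BoolMat n, A' ≠ X * A := by
  classical
  obtain ⟨i, hi⟩ := h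
  have hj : ∃ j, ∀ a, ¬ ∀ b, A a b = 1 ↔ b = j := by
    by_contra! hcon
    choose f hf using hcon
    have hinj : Function.Injective f := fun a b hab => by
      have h1 := hf a
      rw [hab] at h1
      exact (hf b a).1 ((h1 a).2 rfl)
    obtain ⟨j, hj⟩ := Finite.surjective_of_injective hinj i
    exact hi j (hj ▸ (hf j j).2 rfl)
  obtain ⟨j, hj⟩ := hj
  refine ⟨zeroDiag i, ofRel fun a b => (a = i ∧ b = j) ∨ A a b = 1, zeroDiag_similar i,
    ext_one fun a b => ?_, fun X hX => ?_⟩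
  · rw [mul_apply_eq_one]
    simp only [zeroDiag, ofRel_apply]
    constructor
    · exact fun hab => ⟨a, ⟨rfl, fun hai => hi b (hai ▸ hab)⟩, Or.inr hab⟩
    · rintro ⟨k, ⟨rfl, hk⟩, ⟨hki, -⟩ | hkb⟩
      · exact absurd hki hk
      · exact hkb
  · have key : ∀ b, (X * A) i b = 1 ↔ b = j := fun b => by
      rw [← hX, ofRel_apply]
      simp [hi]
    obtain ⟨k, hk, hkj⟩ := (mul_apply_eq_one _ _ _ _).1 ((key j).2 rfl)
    refine hj k fun b => ⟨fun hb => (key b).1 ((mul_apply_eq_one _ _ _ _).2 ⟨k, hk, hb⟩), ?_⟩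
    rintro rfl
    exact hkj

/-- The number of ones of a Boolean matrix. -/
noncomputable def ones (A : BoolMat n) : ℕ := {p : Fin n × Fin n | A p.1 p.2 = 1}.ncard

theorem ones_transpose (A : BoolMat n) : ones A.transpose = ones A := by
  unfold ones
  rw [← Set.ncard_image_of_injective _ Prod.swap_injective]
  congr 1
  ext ⟨a, b⟩
  simp

/-- The ones of row `i` are deleted from row `j`; the elementary factor adds row `i` back to row
`j`. -/
theorem exists_factor_of_row_le {A : BoolMat n} {i j : Fin n} (hij : i ≠ j)
    (hi : ∃ k, A i k = 1) (hle : ∀ k, A i k = 1 → A j k = 1) :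
    ∃ G A' : BoolMat n, IsElementary G ∧ A = G * A' ∧ ones A' < ones A := by
  refine ⟨transvec j i, ofRel fun a b => A a b = 1 ∧ (a = j → A i b ≠ 1),
    transvec_isElementary hij.symm, ext_one fun a b => ?_, Set.ncard_lt_ncard ⟨?_, fun hs => ?_⟩⟩
  · rw [mul_apply_eq_one]
    simp only [transvec, ofRel_apply]
    constructor
    · intro hab
      by_cases h : a = j ∧ A i b = 1
      · exact ⟨i, Or.inr ⟨h.1, rfl⟩, h.2, fun h' => absurd h' hij⟩
      · exact ⟨a, Or.inl rfl, hab, fun h1 h2 => h ⟨h1, h2⟩⟩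
    · rintro ⟨k, rfl | ⟨rfl, rfl⟩, hk, -⟩
      · exact hk
      · exact hle b hk
  · rintro ⟨a, b⟩ h
    exact ((ofRel_apply _ _ _).1 h).1
  · obtain ⟨k, hk⟩ := hi
    have : (j, k) ∈ {p : Fin n × Fin n | A p.1 p.2 = 1} := hle k hk
    exact ((ofRel_apply _ _ _).1 (hs this)).2 rfl hk

/-! ### Generation by units, elementary matrices, copies of `F` and primes -/

/-- Column `j` of `A * M` is the union of the columns `k` of `A` with `M k j = 1`. Each of these
lies below column `j` of `A`, so `k = j`; the union is nonempty because column `j` is nonzero. -/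
theorem eq_one_of_mul_eq_self {A M : BoolMat n} (h0 : ¬ HasZeroCol A)
    (hinc : ∀ i j, (∀ k, A k i = 1 → A k j = 1) → i = j) (h : A * M = A) : M = 1 := by
  have h1 : ∀ k j, M k j = 1 → k = j := fun k j hkj => hinc k j fun i hi => by
    rw [← h, mul_apply_eq_one]
    exact ⟨k, hi, hkj⟩
  refine ext_one fun k j => ?_
  rw [one_apply_eq_one]
  refine ⟨h1 k j, ?_⟩
  rintro rfl
  simp only [HasZeroCol, not_exists, not_forall, not_not] at h0
  obtain ⟨i, hi⟩ := h0 k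
  rw [← h, mul_apply_eq_one] at hi
  obtain ⟨l, -, hl⟩ := hi
  rwa [h1 l k hl] at hl

theorem eq_top_of_forall_mem (hn : 1 < n) (H : Subsemigroup (BoolMat n))
    (hU : ∀ A, IsUnit A → A ∈ H) (hE : ∀ A, IsElementary A → A ∈ H)
    (hF : ∀ A, Similar A (matF n) → A ∈ H) (hP : ∀ A, IsPrimeMatrix A → A ∈ H) : H = ⊤ := by
  -- Lexicographic induction: `s` bounds how far `idealSize A` is from its upper bound `2 * Nat.card
  -- (BoolMat n)`, and `o` bounds the number of ones.
  have main : ∀ s : ℕ, ∀ o : ℕ, ∀ A : BoolMat n,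
      2 * Nat.card (BoolMat n) - idealSize A ≤ s → ones A ≤ o → A ∈ H := by
    intro s
    induction s using Nat.strong_induction_on with
    | _ s ihs =>
    intro o
    induction o using Nat.strong_induction_on with
    | _ o iho =>
    intro A hs ho
    have big : ∀ B : BoolMat n, idealSize A < idealSize B → B ∈ H := fun B hB => by
      have := idealSize_le B
      exact ihs (2 * Nat.card (BoolMat n) - idealSize B) (by omega) _ B le_rfl le_rfl
    have small : ∀ B : BoolMat n, idealSize A ≤ idealSize B → ones B < ones A → B ∈ H :=
      fun B hB hB' => iho (ones B) (by omega) B (by omega) le_rfl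
    by_cases hAu : IsUnit A
    · exact hU A hAu
    by_cases hAp : IsPrimeMatrix A
    · exact hP A hAp
    by_cases hzr : HasZeroRow A
    · obtain ⟨G, A', hG, hGA, hX⟩ := exists_factor_of_hasZeroRow hzr
      rw [hGA] at hX big ⊢
      exact H.mul_mem (hF G hG) (big A' (idealSize_lt_right hX))
    by_cases hzc : HasZeroCol A
    · obtain ⟨G, A', hG, hGA, hX⟩ := exists_factor_of_hasZeroRow (A := A.transpose) hzc
      have hGA' : A = A'.transpose * G.transpose := by
        rw [← Matrix.transpose_mul, ← hGA, Matrix.transpose_transpose]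
      have hX' : ∀ X, A'.transpose ≠ A'.transpose * G.transpose * X := fun X hX1 => by
        refine hX X.transpose ?_
        rw [← Matrix.transpose_mul, hGA', ← hX1, Matrix.transpose_transpose]
      rw [hGA'] at big ⊢
      refine H.mul_mem (big _ (idealSize_lt_left hX')) (hF _ ?_)
      have := Similar.transpose hG
      rwa [matF_transpose] at this
    by_cases hr : ∃ i j, i ≠ j ∧ ∀ k, A i k = 1 → A j k = 1
    · obtain ⟨i, j, hij, hle⟩ := hr
      obtain ⟨G, A', hG, hGA, hlt⟩ := exists_factor_of_row_le hij (by
        by_contra! h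
        exact hzr ⟨i, h⟩) hle
      have := small A' (hGA ▸ idealSize_le_right _ _) hlt
      rw [hGA]
      exact H.mul_mem (hE G hG) this
    by_cases hc : ∃ i j, i ≠ j ∧ ∀ k, A k i = 1 → A k j = 1
    · obtain ⟨i, j, hij, hle⟩ := hc
      obtain ⟨G, A', hG, hGA, hlt⟩ := exists_factor_of_row_le (A := A.transpose) hij (by
        by_contra! h
        exact hzc ⟨i, h⟩) hle
      have hGA' : A = A'.transpose * G.transpose := by
        rw [← Matrix.transpose_mul, ← hGA, Matrix.transpose_transpose]
      have := small A'.transpose (hGA' ▸ idealSize_le_left _ _)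
        (by rwa [ones_transpose, ← ones_transpose A])
      rw [hGA']
      exact H.mul_mem this (hE _ (hG.transpose hn))
    push Not at hr hc
    have hBC : ∃ B C : BoolMat n, A = B * C ∧ ¬ IsUnit B ∧ ¬ IsUnit C := by
      by_contra! hcon
      exact hAp ⟨hAu, fun B C h => or_iff_not_imp_left.2 fun hB => by
        by_contra hC
        exact hC (hcon B C h hB)⟩
    obtain ⟨B, C, hBC, hB, hC⟩ := hBC
    have h1 : idealSize A < idealSize B := by
      rw [hBC]
      -- If `B = A * x`, then `A * (x * C) = B * C = A`, so `x * C = 1` and `C` would be a unit.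
      refine idealSize_lt_left fun x hx => hC ?_
      refine (isUnit_of_mul_eq_one_of_finite (a := x) ?_).2
      refine eq_one_of_mul_eq_self hzc (fun i j hle => ?_) (M := x * C) ?_
      · by_contra hij
        obtain ⟨k, hk, hk'⟩ := hc i j hij
        exact hk' (hle k hk)
      · rw [← mul_assoc, hBC, ← hx]
    have h2 : idealSize A < idealSize C := by
      rw [hBC]
      refine idealSize_lt_right fun x hx => hB ?_
      refine (isUnit_of_mul_eq_one_of_finite (b := x) ?_).1
      rw [← Matrix.transpose_inj, Matrix.transpose_one]
      refine eq_one_of_mul_eq_self (A := A.transpose) hzr (fun i j hle => ?_) ?_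
      · by_contra hij
        obtain ⟨k, hk, hk'⟩ := hr i j hij
        exact hk' (hle k hk)
      · rw [← Matrix.transpose_mul, Matrix.transpose_inj]
        calc B * x * A = B * (x * (B * C)) := by rw [mul_assoc, ← hBC]
          _ = A := by rw [← hx, hBC]
    rw [hBC]
    exact H.mul_mem (big B h1) (big C h2)
  exact eq_top_iff.2 fun A _ => main _ _ A le_rfl le_rfl

end BoolMat

/-! ### Generating sets of semigroups -/

theorem exists_mem_of_generates {S : Type*} [Semigroup S] {Y : Set S} (hY : Generates Y)
    (p : S → Prop) (hp : ∀ a b, p (a * b) → p a ∨ p b) {x : S} (hx : p x) : ∃ y ∈ Y, p y := by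
  have hmem : x ∈ Subsemigroup.closure Y := by
    rw [show Subsemigroup.closure Y = ⊤ from hY]; trivial
  induction hmem using Subsemigroup.closure_induction with
  | mem y hy => exact ⟨y, hy, hx⟩
  | mul a b _ _ iha ihb => exact (hp a b hx).elim iha ihb

/-- In a finite monoid every factor of a unit is a unit, so a word for a unit uses only unit
generators. -/
theorem closure_inter_isUnit {M : Type*} [Monoid M] [Finite M] {Y : Set M} (hY : Generates Y) :
    (Subsemigroup.closure (Y ∩ {a | IsUnit a}) : Set M) = {a | IsUnit a} := by
  apply Set.Subset.antisymm
  · intro a ha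
    induction ha using Subsemigroup.closure_induction with
    | mem y hy => exact hy.2
    | mul a b _ _ iha ihb => exact IsUnit.mul iha ihb
  · intro a ha
    have hmem : a ∈ Subsemigroup.closure Y := by
      rw [show Subsemigroup.closure Y = ⊤ from hY]; trivial
    induction hmem using Subsemigroup.closure_induction with
    | mem y hy => exact Subsemigroup.subset_closure ⟨hy, ha⟩
    | mul a b _ _ iha ihb =>
      obtain ⟨h1, h2⟩ := isUnit_mul_iff_of_finite.1 ha
      exact Subsemigroup.mul_mem _ (iha h1) (ihb h2)

theorem commute_of_subsingleton_generators {S : Type*} [Semigroup S] {Y : Set S}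
    (hY : Y.Subsingleton) {a b : S} (ha : a ∈ Subsemigroup.closure Y)
    (hb : b ∈ Subsemigroup.closure Y) : a * b = b * a := by
  have h1 : ∀ y ∈ Y, ∀ a ∈ Subsemigroup.closure Y, a * y = y * a := fun y hy a ha => by
    induction ha using Subsemigroup.closure_induction with
    | mem z hz => rw [hY hz hy]
    | mul c d _ _ ihc ihd => rw [mul_assoc, ihd, ← mul_assoc, ihc, mul_assoc]
  induction hb using Subsemigroup.closure_induction with
  | mem y hy => exact h1 y hy a ha
  | mul c d _ _ ihc ihd => rw [← mul_assoc, ihc, mul_assoc, ihd, mul_assoc]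

theorem isMinimalGeneratingSet_of_ncard_le {S : Type*} [Semigroup S] [Finite S] {X : Set S}
    (hX : Generates X) (h : ∀ Y : Set S, Generates Y → X.ncard ≤ Y.ncard) :
    IsMinimalGeneratingSet X := by
  refine ⟨hX, fun Y hYX hY => absurd (h Y hY) (not_le.2 (Set.ncard_lt_ncard hYX)), ?_⟩
  refine le_antisymm (le_csInf ⟨_, X, hX, rfl⟩ ?_) (csInf_le' ⟨X, hX, rfl⟩)
  rintro _ ⟨Y, hY, rfl⟩
  rw [← Set.cast_ncard X.toFinite, ← Set.cast_ncard Y.toFinite]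
  exact_mod_cast h Y hY

theorem IsMinimalGeneratingSet.ncard_le {S : Type*} [Semigroup S] [Finite S] {X Y : Set S}
    (hX : IsMinimalGeneratingSet X) (hY : Generates Y) : X.ncard ≤ Y.ncard := by
  have h : Cardinal.mk X ≤ Cardinal.mk Y := hX.2.2.trans_le (csInf_le' ⟨Y, hY, rfl⟩)
  rw [← Set.cast_ncard X.toFinite, ← Set.cast_ncard Y.toFinite] at h
  exact_mod_cast h

/-! ### Generators of the symmetric group -/

namespace BoolMat

open BoolSemiring

variable {n : ℕ}

theorem setOf_isUnit_eq : {A : BoolMat n | IsUnit A} = symmetricGroup n :=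
  Set.ext isUnit_iff_mem_symmetricGroup

/-- An `n`-cycle and an adjacent transposition generate `S_n` as a group; finite orders make
inverses positive powers, so they also generate it as a semigroup. -/
theorem exists_generateSymmetricGroup (hn : 2 ≤ n) :
    ∃ T U : BoolMat n, GenerateSymmetricGroup T U := by
  set σ : Equiv.Perm (Fin n) := finRotate n
  set τ : Equiv.Perm (Fin n) := Equiv.swap ⟨0, by omega⟩ (σ ⟨0, by omega⟩)
  have htop := Equiv.Perm.closure_cycle_adjacent_swap (isCycle_finRotate_of_le hn)
    (support_finRotate_of_le hn) ⟨0, by omega⟩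
  refine ⟨σ.permMatrix _, τ.permMatrix _, Set.Subset.antisymm (fun A hA => ?_) ?_⟩
  · rw [← isUnit_iff_mem_symmetricGroup]
    induction hA using Subsemigroup.closure_induction with
    | mem y hy => rcases hy with rfl | rfl <;> exact isUnit_permMatrix _
    | mul a b _ _ iha ihb => exact IsUnit.mul iha ihb
  · rintro _ ⟨g, rfl⟩
    set K := Subsemigroup.closure {σ.permMatrix BoolSemiring, τ.permMatrix BoolSemiring}
    have hpow : ∀ (g : Equiv.Perm (Fin n)) (k : ℕ), g.permMatrix BoolSemiring ∈ K →
        (g ^ (k + 1)).permMatrix BoolSemiring ∈ K := fun g k hg => by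
      induction k with
      | zero => simpa using hg
      | succ k ih =>
        rw [pow_succ, Matrix.permMatrix_mul]
        exact K.mul_mem hg ih
    have hσ : σ.permMatrix BoolSemiring ∈ K := Subsemigroup.subset_closure (Or.inl rfl)
    have hone : (1 : Equiv.Perm (Fin n)).permMatrix BoolSemiring ∈ K := by
      have := hpow σ (orderOf σ - 1) hσ
      rwa [Nat.sub_add_cancel (orderOf_pos σ), pow_orderOf_eq_one] at this
    have hg : g ∈ Subgroup.closure {σ, τ} := by
      rw [show Subgroup.closure {σ, τ} = ⊤ from htop]; trivial
    change g.permMatrix BoolSemiring ∈ K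
    induction hg using Subgroup.closure_induction with
    | mem y hy =>
      rcases hy with rfl | rfl
      · exact hσ
      · exact Subsemigroup.subset_closure (Or.inr rfl)
    | one => exact hone
    | mul a b _ _ iha ihb =>
      -- `permMatrix` reverses products.
      rw [Matrix.permMatrix_mul]
      exact K.mul_mem ihb iha
    | inv a _ iha =>
      -- The inverse is `a ^ (orderOf a - 1)`. Order one is separate because `hpow` covers only
      -- positive exponents.
      rcases h : orderOf a - 1 with _ | k
      · have : orderOf a = 1 := by have := orderOf_pos a; omega
        rw [orderOf_eq_one_iff.1 this, inv_one]
        exact hone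
      · have hk : a ^ (k + 1) * a = 1 := by
          rw [← pow_succ, show k + 1 + 1 = orderOf a by omega, pow_orderOf_eq_one]
        rw [← eq_inv_of_mul_eq_one_left hk]
        exact hpow a k iha

theorem exists_not_commute (hn : 2 < n) :
    ∃ A B : BoolMat n, IsUnit A ∧ IsUnit B ∧ A * B ≠ B * A := by
  set z : Fin n := ⟨0, by omega⟩ with hz
  set o : Fin n := ⟨1, by omega⟩ with ho
  set t : Fin n := ⟨2, by omega⟩ with ht
  refine ⟨(Equiv.swap z o).permMatrix _, (Equiv.swap o t).permMatrix _, isUnit_permMatrix _,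
    isUnit_permMatrix _, fun h => ?_⟩
  rw [← Matrix.permMatrix_mul, ← Matrix.permMatrix_mul] at h
  have h1 := (permMatrix_apply_eq_one _ z _).2 (rfl : (Equiv.swap o t * Equiv.swap z o) z = _)
  rw [h, permMatrix_apply_eq_one, Equiv.Perm.mul_apply, Equiv.Perm.mul_apply,
    Equiv.swap_apply_left, Equiv.swap_apply_left,
    Equiv.swap_apply_of_ne_of_ne (a := o) (b := t) (x := z) (by simp [hz, ho]) (by simp [hz, ht]),
    Equiv.swap_apply_left] at h1
  simp [ho, ht] at h1

theorem two_le_ncard_inter_isUnit (hn : 2 < n) {Y : Set (BoolMat n)} (hY : Generates Y) :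
    2 ≤ (Y ∩ {A | IsUnit A}).ncard := by
  by_contra h
  have hs : (Y ∩ {A | IsUnit A}).Subsingleton := Set.ncard_le_one_iff_subsingleton.1 (by omega)
  obtain ⟨A, B, hA, hB, hAB⟩ := exists_not_commute hn
  have hcl := closure_inter_isUnit hY
  refine hAB (commute_of_subsingleton_generators hs ?_ ?_)
  · rw [← SetLike.mem_coe, hcl]; exact hA
  · rw [← SetLike.mem_coe, hcl]; exact hB

/-! ### Separating units, elementary matrices, primes and the rest -/

theorem not_isUnit_of_hasZeroRow {A : BoolMat n} (h : HasZeroRow A) : ¬ IsUnit A := fun hu => by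
  obtain ⟨B, hB⟩ := hu.exists_right_inv
  obtain ⟨i, hi⟩ := h
  have h1 : (A * B) i i = 1 := by rw [hB, one_apply_eq_one]
  obtain ⟨k, hk, -⟩ := (mul_apply_eq_one _ _ _ _).1 h1
  exact hi k hk

theorem matE_mul_self : matE n * matE n = matE n := ext_one fun i j => by
  simp only [mul_apply_eq_one, matE_apply_eq_one]
  constructor
  · rintro ⟨k, rfl | h, rfl | h'⟩
    · exact Or.inl rfl
    · exact Or.inr h'
    · exact Or.inr h
    · omega
  · exact fun h => ⟨i, Or.inl rfl, h⟩

theorem matE_not_isUnit (hn : 1 < n) : ¬ IsUnit (matE n) := fun h => by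
  have h1 : matE n = 1 := h.mul_left_cancel (by rw [matE_mul_self, mul_one])
  have h2 : matE n ⟨1, hn⟩ ⟨0, by omega⟩ = 1 := (matE_apply_eq_one _ _).2 (Or.inr ⟨rfl, rfl⟩)
  rw [h1, one_apply_eq_one] at h2
  simp at h2

theorem IsElementary.not_isUnit {A : BoolMat n} (h : IsElementary A) (hn : 1 < n) :
    ¬ IsUnit A := fun hu => matE_not_isUnit hn ((Similar.isUnit_iff h).1 hu)

/-- `E` is idempotent, so primality applied to `E = E * E` would make `E` a unit. -/
theorem IsElementary.not_isPrimeMatrix {A : BoolMat n} (h : IsElementary A) :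
    ¬ IsPrimeMatrix A := fun hp => by
  have := hp.similar h
  exact this.1 ((this.2 _ _ matE_mul_self.symm).elim id id)

theorem IsElementary.not_hasZeroRow {A : BoolMat n} (h : IsElementary A) : ¬ HasZeroRow A :=
  fun hz => by
    obtain ⟨i, hi⟩ := hz.similar h
    exact hi i ((matE_apply_eq_one _ _).2 (Or.inl rfl))

theorem IsPrimeMatrix.not_hasZeroRow {A : BoolMat n} (h : IsPrimeMatrix A) : ¬ HasZeroRow A := by
  rintro ⟨i, hi⟩
  have hG : A = zeroDiag i * A := ext_one fun a b => by
    simp only [mul_apply_eq_one, zeroDiag, ofRel_apply]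
    constructor
    · exact fun hab => ⟨a, ⟨rfl, fun hai => hi b (hai ▸ hab)⟩, hab⟩
    · rintro ⟨k, ⟨rfl, -⟩, hk⟩
      exact hk
  rcases h.2 _ _ hG with h' | h'
  · refine not_isUnit_of_hasZeroRow ⟨i, fun j hj => ?_⟩ h'
    exact ((ofRel_apply _ _ _).1 hj).2 rfl
  · exact h.1 h'

theorem hasZeroRow_matF (hn : 0 < n) : HasZeroRow (matF n) :=
  ⟨⟨0, hn⟩, fun _ hj => ((matF_apply_eq_one _ _).1 hj).2 rfl⟩

theorem hasZeroCol_matF (hn : 0 < n) : HasZeroCol (matF n) :=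
  ⟨⟨0, hn⟩, fun i hi => by
    have := (matF_apply_eq_one _ _).1 hi
    exact this.2 (congrArg Fin.val this.1)⟩

/-! ### What every generating set must contain -/

theorem exists_isPrimeRepresentatives (n : ℕ) :
    ∃ P : Set (BoolMat n), IsPrimeRepresentatives P := by
  let s : Setoid (BoolMat n) := ⟨Similar, Similar.refl, Similar.symm, Similar.trans⟩
  have hout : ∀ A : BoolMat n, Similar (Quotient.out (s := s) ⟦A⟧) A :=
    fun A => Quotient.mk_out (s := s) A
  refine ⟨{B | ∃ A, IsPrimeMatrix A ∧ B = Quotient.out (s := s) ⟦A⟧},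
    (isPrimeRepresentatives_iff _).2 ⟨?_, fun A hA => ?_⟩⟩
  · rintro _ ⟨A, hA, rfl⟩
    exact hA.similar (hout A).symm
  · refine ⟨_, ⟨⟨A, hA, rfl⟩, (hout A).symm⟩, ?_⟩
    rintro _ ⟨⟨C, hC, rfl⟩, hAC⟩
    have : (⟦C⟧ : Quotient s) = ⟦A⟧ := Quotient.sound (s := s) (hAC.trans (hout C)).symm
    rw [this]

/-- If a product is similar to a prime, one factor is a unit and the other is similar to that prime.
Hence every prime is similar to some generator, and choosing one for each element of `P` is
injective. -/
theorem exists_isPrimeRepresentatives_subset {P Y : Set (BoolMat n)}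
    (hP : IsPrimeRepresentatives P) (hY : Generates Y) :
    ∃ Q, Q ⊆ Y ∩ {A | IsPrimeMatrix A} ∧ IsPrimeRepresentatives Q ∧ Q.ncard = P.ncard := by
  rw [isPrimeRepresentatives_iff] at hP
  have h1 : ∀ A : BoolMat n, ∃ B, IsPrimeMatrix A → B ∈ Y ∧ Similar A B := fun A => by
    by_cases hA : IsPrimeMatrix A
    · obtain ⟨B, hB, hAB⟩ := exists_mem_of_generates hY (fun B => Similar A B)
        (fun B C hBC => by
          rcases (hA.similar hBC).2 B C rfl with h | h
          · exact Or.inr (hBC.trans (similar_mul_left h C))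
          · exact Or.inl (hBC.trans (similar_mul_right h B))) (Similar.refl A)
      exact ⟨B, fun _ => ⟨hB, hAB⟩⟩
    · exact ⟨A, fun h => absurd h hA⟩
  choose f hf using h1
  have key : ∀ A, IsPrimeMatrix A → ∀ p ∈ P, ∀ q ∈ P, Similar A (f p) → Similar A (f q) → p = q := by
    intro A hA p hp q hq hAp hAq
    exact (hP.2 A hA).unique ⟨hp, hAp.trans (hf p (hP.1 p hp)).2.symm⟩
      ⟨hq, hAq.trans (hf q (hP.1 q hq)).2.symm⟩
  refine ⟨f '' P, ?_, (isPrimeRepresentatives_iff _).2 ⟨?_, fun A hA => ?_⟩, ?_⟩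
  · rintro _ ⟨p, hp, rfl⟩
    exact ⟨(hf p (hP.1 p hp)).1, (hP.1 p hp).similar (hf p (hP.1 p hp)).2⟩
  · rintro _ ⟨p, hp, rfl⟩
    exact (hP.1 p hp).similar (hf p (hP.1 p hp)).2
  · obtain ⟨p, ⟨hp, hAp⟩, -⟩ := hP.2 A hA
    refine ⟨f p, ⟨⟨p, hp, rfl⟩, hAp.trans (hf p (hP.1 p hp)).2⟩, ?_⟩
    rintro _ ⟨⟨q, hq, rfl⟩, hAq⟩
    rw [key A hA q hq p hp hAq (hAp.trans (hf p (hP.1 p hp)).2)]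
  · refine Set.InjOn.ncard_image fun p hp q hq hpq => ?_
    have hfp := hf p (hP.1 p hp)
    exact key p (hP.1 p hp) p hp q hq hfp.2 (hpq ▸ hfp.2)

theorem ncard_eq_add (hn : 1 < n) (Y : Set (BoolMat n)) :
    Y.ncard = (Y ∩ {A | IsUnit A}).ncard + (Y ∩ {A | IsElementary A}).ncard +
      (Y ∩ {A | IsPrimeMatrix A}).ncard +
      (Y ∩ {A | ¬ IsUnit A ∧ ¬ IsElementary A ∧ ¬ IsPrimeMatrix A}).ncard := by
  rw [← Set.ncard_union_eq, ← Set.ncard_union_eq, ← Set.ncard_union_eq]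
  · congr 1
    ext A
    simp only [Set.mem_union, Set.mem_inter_iff, Set.mem_ofPred_eq]
    tauto
  · rw [Set.disjoint_left]
    rintro A ((h | h) | h) h' <;>
      simp only [Set.mem_inter_iff, Set.mem_ofPred_eq] at h h' <;> tauto
  · rw [Set.disjoint_left]
    rintro A (h | h) h'
    · exact h'.2.1 h.2
    · exact h.2.not_isPrimeMatrix h'.2
  · rw [Set.disjoint_left]
    exact fun A h h' => h'.2.not_isUnit hn h.2

theorem IsElementary.one_le_ncard {Y : Set (BoolMat n)} (hY : Generates Y) :
    1 ≤ (Y ∩ {A | IsElementary A}).ncard := by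
  obtain ⟨A, hA, hA'⟩ := exists_mem_of_generates hY IsElementary (fun _ _ h => h.of_mul)
    (Similar.refl (matE n))
  exact (Set.ncard_pos).2 ⟨A, hA, hA'⟩

theorem exists_hasZeroRow_mem (hn : 0 < n) {Y : Set (BoolMat n)} (hY : Generates Y) :
    ∃ A ∈ Y ∩ {A | ¬ IsUnit A ∧ ¬ IsElementary A ∧ ¬ IsPrimeMatrix A}, HasZeroRow A := by
  obtain ⟨A, hA, hz⟩ := exists_mem_of_generates hY HasZeroRow (fun _ _ h => h.of_mul)
    (hasZeroRow_matF hn)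
  exact ⟨A, ⟨hA, not_isUnit_of_hasZeroRow hz, fun h => h.not_hasZeroRow hz,
    fun h => h.not_hasZeroRow hz⟩, hz⟩

theorem IsPrimeMatrix.not_hasZeroCol {A : BoolMat n} (h : IsPrimeMatrix A) : ¬ HasZeroCol A := by
  rintro ⟨i, hi⟩
  have hG : A = A * zeroDiag i := ext_one fun a b => by
    simp only [mul_apply_eq_one, zeroDiag, ofRel_apply]
    constructor
    · exact fun hab => ⟨b, hab, rfl, fun hai => hi a (hai ▸ hab)⟩
    · rintro ⟨k, hk, rfl, -⟩
      exact hk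
  rcases h.2 _ _ hG with h' | h'
  · exact h.1 h'
  · refine not_isUnit_of_hasZeroRow ⟨i, fun j hj => ?_⟩ h'
    exact ((ofRel_apply _ _ _).1 hj).2 rfl

theorem IsElementary.not_hasZeroCol {A : BoolMat n} (h : IsElementary A) : ¬ HasZeroCol A :=
  fun hz => by
    obtain ⟨i, hi⟩ := hz.similar h
    exact hi i ((matE_apply_eq_one _ _).2 (Or.inl rfl))

theorem not_isUnit_of_hasZeroCol {A : BoolMat n} (h : HasZeroCol A) : ¬ IsUnit A := fun hu => by
  obtain ⟨B, hB⟩ := hu.exists_left_inv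
  obtain ⟨i, hi⟩ := h
  have h1 : (B * A) i i = 1 := by rw [hB, one_apply_eq_one]
  obtain ⟨k, -, hk⟩ := (mul_apply_eq_one _ _ _ _).1 h1
  exact hi k hk

theorem exists_hasZeroCol_mem (hn : 0 < n) {Y : Set (BoolMat n)} (hY : Generates Y) :
    ∃ A ∈ Y ∩ {A | ¬ IsUnit A ∧ ¬ IsElementary A ∧ ¬ IsPrimeMatrix A}, HasZeroCol A := by
  obtain ⟨A, hA, hz⟩ := exists_mem_of_generates hY HasZeroCol (fun _ _ h => h.of_mul)
    (hasZeroCol_matF hn)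
  exact ⟨A, ⟨hA, not_isUnit_of_hasZeroCol hz, fun h => h.not_hasZeroCol hz,
    fun h => h.not_hasZeroCol hz⟩, hz⟩

/-- Generators are stripped from the left of a word for `F`. By `similar_matF_mul`, either the rest
of the word is still similar to `F`, or the stripped generator has a zero row, hence by `h` a zero
column, and is itself similar to `F`. -/
theorem exists_similar_matF_mem (hn : 0 < n) {Y : Set (BoolMat n)} (hY : Generates Y)
    (h : ∀ A ∈ Y, HasZeroRow A → HasZeroCol A) : ∃ A ∈ Y, Similar A (matF n) := by
  have key : ∀ A ∈ Subsemigroup.closure Y,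
      (∀ C, Similar (A * C) (matF n) → (∃ A ∈ Y, Similar A (matF n)) ∨ Similar C (matF n)) ∧
      (Similar A (matF n) → ∃ A ∈ Y, Similar A (matF n)) := fun A hA => by
    induction hA using Subsemigroup.closure_induction with
    | mem y hy =>
      refine ⟨fun C hC => ?_, fun hs => ⟨y, hy, hs⟩⟩
      rcases similar_matF_mul hn hC with h1 | ⟨h1, h2⟩
      · exact Or.inr h1
      · exact Or.inl ⟨y, hy, h2 (h y hy h1)⟩
    | mul a b _ _ iha ihb =>
      refine ⟨fun C hC => ?_, fun hs => ?_⟩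
      · rw [mul_assoc] at hC
        exact (iha.1 _ hC).elim Or.inl (ihb.1 C)
      · exact (iha.1 b hs).elim id ihb.2
  refine (key (matF n) ?_).2 (Similar.refl _)
  rw [show Subsemigroup.closure Y = ⊤ from hY]; trivial

/-! ### Counting and the equality case -/

theorem generates_of_form (hn : 1 < n) {T U E F : BoolMat n} {P : Set (BoolMat n)}
    (hTU : GenerateSymmetricGroup T U) (hE : IsElementary E) (hF : Similar F (matF n))
    (hP : IsPrimeRepresentatives P) : Generates ({T, U, E, F} ∪ P) := by
  set H := Subsemigroup.closure ({T, U, E, F} ∪ P) with hH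
  have hU : ∀ A : BoolMat n, IsUnit A → A ∈ H := fun A hA => by
    rw [isUnit_iff_mem_symmetricGroup, ← hTU] at hA
    refine Subsemigroup.closure_mono ?_ hA
    rintro _ (rfl | rfl)
    · exact Or.inl (Or.inl rfl)
    · exact Or.inl (Or.inr (Or.inl rfl))
  have hsim : ∀ A B : BoolMat n, A ∈ ({T, U, E, F} ∪ P : Set (BoolMat n)) → Similar A B → B ∈ H :=
    fun A B hA hAB => by
      obtain ⟨V, W, hV, hW, rfl⟩ := (similar_iff _ _).1 hAB
      exact H.mul_mem (H.mul_mem (hU V hV) (Subsemigroup.subset_closure hA)) (hU W hW)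
  refine eq_top_of_forall_mem hn H hU (fun A hA => ?_) (fun A hA => ?_) (fun A hA => ?_)
  · exact hsim E A (by simp) (Similar.trans hE (Similar.symm hA))
  · exact hsim F A (by simp) (hF.trans hA.symm)
  · obtain ⟨B, ⟨hB, hAB⟩, -⟩ := ((isPrimeRepresentatives_iff P).1 hP).2 A hA
    exact hsim B A (Or.inr hB) hAB.symm

theorem ncard_form_le (T U E F : BoolMat n) (P : Set (BoolMat n)) :
    ({T, U, E, F} ∪ P : Set (BoolMat n)).ncard ≤ 4 + P.ncard := by
  classical
  refine (Set.ncard_union_le _ _).trans (Nat.add_le_add_right ?_ _)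
  have h := Finset.card_le_four (a := T) (b := U) (c := E) (d := F)
  rw [← Set.ncard_coe_finset] at h
  simpa using h

theorem exists_form_of_isMinimalGeneratingSet (hn : 2 < n) {X : Set (BoolMat n)}
    (hX : IsMinimalGeneratingSet X) :
    ∃ (T' U' E' F' : BoolMat n) (P : Set (BoolMat n)), GenerateSymmetricGroup T' U' ∧
      IsElementary E' ∧ Similar F' (matF n) ∧ IsPrimeRepresentatives P ∧
      X = {T', U', E', F'} ∪ P := by
  have hG := hX.1
  obtain ⟨T, U, hTU⟩ := exists_generateSymmetricGroup (n := n) (by omega)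
  obtain ⟨P, hP⟩ := exists_isPrimeRepresentatives n
  have hle := (hX.ncard_le (generates_of_form (by omega) hTU (Similar.refl _)
    (Similar.refl _) hP)).trans (ncard_form_le T U (matE n) (matF n) P)
  obtain ⟨Q, hQX, hQ, hQP⟩ := exists_isPrimeRepresentatives_subset hP hG
  have hcard := ncard_eq_add (by omega) X
  have hu := two_le_ncard_inter_isUnit hn hG
  have he := IsElementary.one_le_ncard hG
  have hp := Set.ncard_le_ncard hQX (Set.toFinite _)
  obtain ⟨Z, hZ, hZr⟩ := exists_hasZeroRow_mem (by omega) hG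
  obtain ⟨Z', hZ', hZc⟩ := exists_hasZeroCol_mem (by omega) hG
  have hr := (Set.ncard_pos (Set.toFinite _)).2 ⟨Z, hZ⟩
  -- The four parts have at least `2`, `1`, `P.ncard` and `1` elements, and `X` has at most `4 +
  -- P.ncard`, so every bound is attained.
  obtain ⟨T', U', -, hTU'⟩ := Set.ncard_eq_two.1 (show (X ∩ {A | IsUnit A}).ncard = 2 by omega)
  obtain ⟨E', hE'⟩ := Set.ncard_eq_one.1 (show (X ∩ {A | IsElementary A}).ncard = 1 by omega)
  obtain ⟨F', hF'⟩ := Set.ncard_eq_one.1 (show (X ∩ {A : BoolMat n |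
    ¬ IsUnit A ∧ ¬ IsElementary A ∧ ¬ IsPrimeMatrix A}).ncard = 1 by omega)
  have hQ' := Set.eq_of_subset_of_ncard_le hQX (by omega) (Set.toFinite _)
  have hrest : ∀ A ∈ X, ¬ IsUnit A → ¬ IsElementary A → ¬ IsPrimeMatrix A → A = F' :=
    fun A hA h1 h2 h3 => by
      have : A ∈ ({F'} : Set (BoolMat n)) := hF' ▸ ⟨hA, h1, h2, h3⟩
      exact this
  have hZ'F : Z' = F' := hrest Z' hZ'.1 hZ'.2.1 hZ'.2.2.1 hZ'.2.2.2
  -- Every generator with a zero row is `F' = Z'`, which has a zero column.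
  obtain ⟨W, hW, hWF⟩ := exists_similar_matF_mem (by omega) hG fun A hA hz => by
    rw [hrest A hA (not_isUnit_of_hasZeroRow hz) (fun h => h.not_hasZeroRow hz)
      (fun h => h.not_hasZeroRow hz), ← hZ'F]
    exact hZc
  have hWz := (hasZeroRow_matF (n := n) (by omega)).similar hWF.symm
  have hWF' : W = F' := hrest W hW (not_isUnit_of_hasZeroRow hWz)
    (fun h => h.not_hasZeroRow hWz) (fun h => h.not_hasZeroRow hWz)
  refine ⟨T', U', E', F', Q, ?_, ?_, hWF' ▸ hWF, hQ, ?_⟩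
  · have := closure_inter_isUnit hG
    rwa [hTU', setOf_isUnit_eq] at this
  · have : E' ∈ X ∩ {A | IsElementary A} := hE' ▸ rfl
    exact this.2
  · have h4 : ({T', U', E', F'} : Set (BoolMat n)) = {T', U'} ∪ {E'} ∪ {F'} := by
      ext A
      simp only [Set.mem_union, Set.mem_insert_iff, Set.mem_singleton_iff]
      tauto
    rw [h4, ← hTU', ← hE', ← hF', hQ']
    ext A
    simp only [Set.mem_union, Set.mem_inter_iff, Set.mem_ofPred_eq]
    tauto

theorem isMinimalGeneratingSet_of_form (hn : 2 < n) {T U E F : BoolMat n} {P : Set (BoolMat n)}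
    (hTU : GenerateSymmetricGroup T U) (hE : IsElementary E) (hF : Similar F (matF n))
    (hP : IsPrimeRepresentatives P) : IsMinimalGeneratingSet ({T, U, E, F} ∪ P) := by
  refine isMinimalGeneratingSet_of_ncard_le (generates_of_form (by omega) hTU hE hF hP)
    fun Y hY => (ncard_form_le T U E F P).trans ?_
  obtain ⟨Q, hQX, hQ, hQP⟩ := exists_isPrimeRepresentatives_subset hP hY
  have hcard := ncard_eq_add (by omega) Y
  have hu := two_le_ncard_inter_isUnit hn hY
  have he := IsElementary.one_le_ncard hY
  have hp := Set.ncard_le_ncard hQX (Set.toFinite _)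
  obtain ⟨Z, hZ, hZr⟩ := exists_hasZeroRow_mem (by omega) hY
  have hr := (Set.ncard_pos (Set.toFinite _)).2 ⟨Z, hZ⟩
  omega

end BoolMat

theorem mainTheorem2 (n : ℕ) (hn : 2 < n) (X : Set (BoolMat n)) :
    IsMinimalGeneratingSet X ↔
      ∃ (T' U' E' F' : BoolMat n) (P : Set (BoolMat n)),
        BoolMat.GenerateSymmetricGroup T' U' ∧
        BoolMat.IsElementary E' ∧
        BoolMat.Similar F' (BoolMat.matF n) ∧
        BoolMat.IsPrimeRepresentatives P ∧
        X = {T', U', E', F'} ∪ P := by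
  refine ⟨BoolMat.exists_form_of_isMinimalGeneratingSet hn, ?_⟩
  rintro ⟨T, U, E, F, P, hTU, hE, hF, hP, rfl⟩
  exact BoolMat.isMinimalGeneratingSet_of_form hn hTU hE hF hP
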